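/- Let $R$ be a commutative Noetherian ring, $I$ an ideal of $R$, and $M$ a linearly compact $R$-module, i.e. a Hausdorff topological $R$-module in which $0$ has a base of neighbourhoods consisting of submodules and in which every family of cosets of closed submodules with the finite intersection property has non-empty intersection. For $i\ge 0$ let $$H^I_i(M)=\varprojlim_t \operatorname{Tor}^R_i(R/I^t,M)$$ be the $i$-th local homology module of $M$ with respect to $I$. Define the Noetherian dimension of an $R$-module recursively: $\operatorname{Ndim} M=-1$ if $M=0$; for an ordinal $\alpha$, $\operatorname{Ndim} M=\alpha$ if $\operatorname{Ndim} M<\alpha$ is false and for every ascending chain $M_0\subseteq M_1\subseteq\cdots$ of submodules of $M$ there is $m_0$ such that $\operatorname{Ndim}(M_{m+1}/M_m)<\alpha$ for all $m\ge m_0$. If $\operatorname{Ndim} M=d$, then $$H^I_i(M)=0\quad\text{for all integers } i\ge 0 \text{ with } i>d.$$ -/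

import Mathlib

open CategoryTheory Opposite

universe u v

/-- An `R`-module `M` with a topology is *linearly compact* if it is a Hausdorff linearly
topologized module (the neighbourhoods of `0` have a base consisting of submodules) in which every
family of closed cosets (cosets of closed submodules) with the finite intersection property has
non-empty intersection.

Multiplication by a fixed scalar is automatically continuous for a linear group topology, i.e. `M`
is a topological module over the discrete ring `R`. If `R` carries a ring topology for which `M` is
a topological module, then `M` is so for the discrete topology on `R` as well; hence no topology
on `R` is needed. -/
structure IsLinearlyCompact (R : Type u) (M : Type v) [CommRing R] [AddCommGroup M] [Module R M]
    [TopologicalSpace M] : Prop where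
  isTopologicalAddGroup : IsTopologicalAddGroup M
  isLinearTopology : IsLinearTopology R M
  t2Space : T2Space M
  nonempty_sInter : ∀ F : Set (Set M),
    (∀ C ∈ F, ∃ (N : Submodule R M) (x : M), IsClosed (N : Set M) ∧ C = (x + ·) '' (N : Set M)) →
    (∀ G : Set (Set M), G ⊆ F → G.Finite → (⋂₀ G).Nonempty) →
    (⋂₀ F).Nonempty

/-- `HasNdim R d M` says that the Noetherian dimension `Ndim M` of the `R`-module `M` exists and
equals `d`, where `d` is `-1` (written `⊥`) or an ordinal. By recursion on `d`:
`Ndim M = -1` iff `M = 0`; and for an ordinal `α`, `Ndim M = α` iff `Ndim M < α` is false and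
for every ascending chain `N 0 ≤ N 1 ≤ …` of submodules of `M` there is `m₀` such that
`Ndim (N (m + 1) / N m) < α` for all `m ≥ m₀`.  Here `Ndim < α` means `Ndim = β` for
some `β < α`. -/
def HasNdim (R : Type u) [CommRing R] (d : WithBot Ordinal.{v})
    (M : Type v) [AddCommGroup M] [Module R M] : Prop :=
  (d = ⊥ ∧ Subsingleton M) ∨
  (d ≠ ⊥ ∧ (¬ ∃ β : WithBot Ordinal.{v}, ∃ _ : β < d, HasNdim R β M) ∧
    ∀ N : ℕ →o Submodule R M, ∃ m₀ : ℕ, ∀ m ≥ m₀,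
      ∃ β : WithBot Ordinal.{v}, ∃ _ : β < d,
        HasNdim R β (↥(N (m + 1)) ⧸ (N m).submoduleOf (N (m + 1))))
termination_by (wellFounded_lt (α := WithBot Ordinal.{v})).wrap d
decreasing_by all_goals assumption

/-- The inverse system `t ↦ Tor_i^R(R / I ^ t, M)` over `ℕᵒᵖ`, with the maps induced by the
canonical projections `R / I ^ s → R / I ^ t` for `t ≤ s`. -/
noncomputable def localHomologyDiagram {R : Type u} [CommRing R] (I : Ideal R) (i : ℕ)
    (M : ModuleCat.{u} R) : ℕᵒᵖ ⥤ ModuleCat.{u} R :=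
  localCohomology.ringModIdeals (localCohomology.idealPowersDiagram I) ⋙
    (Tor' (ModuleCat.{u} R) i).flip.obj M

/-- The `i`-th local homology module `H^I_i(M) = lim_t Tor_i^R(R / I ^ t, M)` of `M` with respect
to the ideal `I`. -/
noncomputable def localHomology {R : Type u} [CommRing R] (I : Ideal R) (i : ℕ)
    (M : ModuleCat.{u} R) : ModuleCat.{u} R :=
  Limits.limit (localHomologyDiagram I i M)

/-! Let `H_i(M)` denote the homology of the homotopy limit over `t` of `P.X t ⊗ M`, where `P.X t`
resolves `R ⧸ I ^ t`. A Milnor-type argument maps `H_i(M)` onto `lim Tor_i(R ⧸ I ^ t, M)`, so it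
suffices that `H_i(M) = 0` when `Ndim M < i`. Unlike the limit of the Tor modules, `H` has long
exact sequences for all short exact sequences of modules.

The vanishing (`vanishes_of_ndimLT`) is a double induction: on `i`, and by Noetherian induction on
an ideal `J` killing `M`. If `I` lies in the radical of `J`, a power of `I` kills `M`; by Artin–Rees
the positive Tor towers are pro-zero, and so `H` vanishes in positive degrees.

Otherwise pick `x ∈ I` outside the radical of `J`. The chain `ker x ^ m` shows that for large `k`
the `x`-torsion of `N = x ^ k M` has smaller dimension (`exists_pow_torsion`). Both `N ⧸ x N` and `M
⧸ N` are killed by ideals strictly larger than `J`. So `x` acts surjectively on `H_i(N)`, and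
derived completeness (`vanishes_of_divisible`) forces `H_i(N) = 0`; the sequence of `N ⊆ M`
concludes. -/

/-- `NdimLT R n M` says that the Noetherian dimension of `M` is smaller than the natural
number `n`. -/
def NdimLT (R : Type u) [CommRing R] :
    ℕ → ∀ (M : Type v) [AddCommGroup M] [Module R M], Prop
  | 0, M, _, _ => Subsingleton M
  | n + 1, M, _, _ => ∀ N : ℕ →o Submodule R M, ∃ m₀ : ℕ, ∀ m ≥ m₀,
      NdimLT R n (↥(N (m + 1)) ⧸ (N m).submoduleOf (N (m + 1)))

/-! ### Modules of Noetherian dimension below a natural number -/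

namespace NdimLT

variable {R : Type u} [CommRing R]

theorem of_subsingleton (n : ℕ) (M : Type v) [AddCommGroup M] [Module R M] [Subsingleton M] :
    NdimLT R n M := by
  induction n generalizing M with
  | zero => assumption
  | succ n ih => exact fun N => ⟨0, fun m _ => ih _⟩

/-- Only the chain condition is retained. Dropping the minimality clause gives an upper bound, which
passes to submodules and quotients, as the induction requires. -/
theorem of_hasNdim {n : ℕ} {M : Type v} [AddCommGroup M] [Module R M]
    {d : WithBot Ordinal.{v}} (hd : HasNdim R d M)
    (h : d < ((n : Ordinal.{v}) : WithBot Ordinal.{v})) : NdimLT R n M := by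
  induction n generalizing M d with
  | zero =>
    rw [HasNdim] at hd
    rcases hd with ⟨-, hM⟩ | ⟨hb, -, -⟩
    · exact hM
    · induction d with
      | bot => exact absurd rfl hb
      | coe d => simp at h
  | succ n ih =>
    rw [HasNdim] at hd
    rcases hd with ⟨-, hM⟩ | ⟨hb, -, hc⟩
    · exact of_subsingleton _ _
    · intro N
      obtain ⟨m₀, hm₀⟩ := hc N
      refine ⟨m₀, fun m hm => ?_⟩
      obtain ⟨β, hβ, hN⟩ := hm₀ m hm
      refine ih hN (hβ.trans_le ?_)
      induction d with
      | bot => exact absurd rfl hb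
      | coe d =>
        rw [WithBot.coe_lt_coe, Nat.cast_succ] at h
        exact WithBot.coe_le_coe.2 (Order.lt_succ_iff.1 (by simpa using h))

variable {M : Type v} [AddCommGroup M] [Module R M] {N : Type v} [AddCommGroup N] [Module R N]

theorem of_injective {n : ℕ} (f : N →ₗ[R] M) (hf : Function.Injective f) (h : NdimLT R n M) :
    NdimLT R n N := by
  induction n generalizing M N with
  | zero =>
    have : Subsingleton M := h
    exact hf.subsingleton
  | succ n ih =>
    intro C
    obtain ⟨m₀, hm₀⟩ := h ⟨fun m => (C m).map f, fun a b hab => Submodule.map_mono (C.2 hab)⟩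
    refine ⟨m₀, fun m hm => ih (Submodule.mapQ _ _ (f.restrict (p := C (m + 1))
      (q := (C (m + 1)).map f) fun x hx => Submodule.mem_map_of_mem hx) ?_) ?_ (hm₀ m hm)⟩
    · rintro ⟨x, hx⟩ h'
      exact Submodule.mem_map_of_mem (f := f) h'
    · refine (injective_iff_map_eq_zero _).2 (Submodule.Quotient.mk_surjective _ |>.forall.2 ?_)
      rintro ⟨x, hx⟩ h'
      have h₀ : (Submodule.Quotient.mk ⟨f x, Submodule.mem_map_of_mem hx⟩ :
          _ ⧸ ((C m).map f).submoduleOf ((C (m + 1)).map f)) = 0 := h'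
      obtain ⟨y, hy, hyx⟩ := (Submodule.Quotient.mk_eq_zero _).1 h₀
      obtain rfl := hf hyx
      exact (Submodule.Quotient.mk_eq_zero _).2 hy

theorem of_surjective {n : ℕ} (f : M →ₗ[R] N) (hf : Function.Surjective f) (h : NdimLT R n M) :
    NdimLT R n N := by
  induction n generalizing M N with
  | zero =>
    have : Subsingleton M := h
    exact hf.subsingleton
  | succ n ih =>
    intro C
    obtain ⟨m₀, hm₀⟩ := h ⟨fun m => (C m).comap f, fun a b hab => Submodule.comap_mono (C.2 hab)⟩
    refine ⟨m₀, fun m hm => ih (Submodule.mapQ _ _ (f.restrict (p := (C (m + 1)).comap f)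
      (q := C (m + 1)) fun x hx => hx) ?_) ?_ (hm₀ m hm)⟩
    · rintro ⟨x, hx⟩ h'
      exact h'
    · refine Submodule.Quotient.mk_surjective _ |>.forall.2 ?_
      rintro ⟨y, hy⟩
      obtain ⟨x, rfl⟩ := hf y
      exact ⟨Submodule.Quotient.mk ⟨x, hy⟩, rfl⟩

/-- If `Ndim M ≤ n`, then for every scalar `x` and every large `k` the submodule of `x ^ k M`
killed by `x` has Noetherian dimension `< n`. -/
theorem exists_pow_torsion {n : ℕ} (h : NdimLT R (n + 1) M) (x : R) :
    ∃ k : ℕ, 1 ≤ k ∧ NdimLT R n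
      (LinearMap.ker (LinearMap.lsmul R (LinearMap.range (LinearMap.lsmul R M (x ^ k))) x)) := by
  obtain ⟨m₀, hm₀⟩ := h ⟨fun m => LinearMap.ker (LinearMap.lsmul R M (x ^ m)), fun a b hab y hy => by
    simp only [LinearMap.mem_ker, LinearMap.lsmul_apply] at hy ⊢
    rw [← Nat.sub_add_cancel hab, pow_add, mul_smul, hy, smul_zero]⟩
  refine ⟨m₀ + 1, by omega, of_surjective ?_ ?_ (hm₀ (m₀ + 1) (by omega))⟩
  -- With `k = m₀ + 1`, the map `y ↦ x ^ k y` sends `ker x ^ (k + 1)` onto the `x`-torsion of `x ^ k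
  -- M` and kills `ker x ^ k`.
  · refine Submodule.liftQ _ (((LinearMap.lsmul R M (x ^ (m₀ + 1))).rangeRestrict.domRestrict
      _).codRestrict _ ?_) ?_
    · rintro ⟨y, hy⟩
      rw [LinearMap.mem_ker]
      apply Subtype.ext
      have : x ^ (m₀ + 1 + 1) • y = 0 := hy
      simpa [pow_succ' x (m₀ + 1), mul_smul] using this
    · rintro ⟨y, hy⟩ hy'
      apply Subtype.ext
      apply Subtype.ext
      exact hy'
  · rintro ⟨⟨_, y, rfl⟩, hy⟩
    refine ⟨Submodule.Quotient.mk ⟨y, ?_⟩, rfl⟩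
    have : x • x ^ (m₀ + 1) • y = 0 := congrArg Subtype.val (LinearMap.mem_ker.1 hy)
    change x ^ (m₀ + 1 + 1) • y = 0
    rw [pow_succ', mul_smul, this]

end NdimLT

/-! ### Towers of flat resolutions and their product complex -/

open scoped TensorProduct

/-- An inverse system of flat resolutions of the modules `R ⧸ I ^ t`, on which the elements of
`I ^ t` act by null-homotopic maps. -/
structure PowerResolution {R : Type u} [CommRing R] (I : Ideal R) where
  /-- The module in degree `n` of the resolution of `R ⧸ I ^ t`. -/
  X : ℕ → ℕ → ModuleCat.{u} R
  /-- The differentials. -/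
  d (t n : ℕ) : X t (n + 1) →ₗ[R] X t n
  /-- The transition maps. -/
  σ (t n : ℕ) : X (t + 1) n →ₗ[R] X t n
  /-- The augmentations. -/
  ε (t : ℕ) : X t 0 →ₗ[R] R ⧸ I ^ t
  d_comp_d (t n : ℕ) : d t n ∘ₗ d t (n + 1) = 0
  d_comp_σ (t n : ℕ) : d t n ∘ₗ σ t (n + 1) = σ t n ∘ₗ d (t + 1) n
  ε_comp_σ (t : ℕ) (y : X (t + 1) 0) :
    ε t (σ t 0 y) = Ideal.Quotient.factor (Ideal.pow_le_pow_right t.le_succ) (ε (t + 1) y)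
  flat (t n : ℕ) : Module.Flat R (X t n)
  exact_d (t n : ℕ) : Function.Exact (d t (n + 1)) (d t n)
  exact_ε (t : ℕ) : Function.Exact (d t 0) (ε t)
  surjective_ε (t : ℕ) : Function.Surjective (ε t)
  homotopy (t : ℕ) (x : R) (hx : x ∈ I ^ t) (n : ℕ) :
    ∃ (h : X t (n + 1) →ₗ[R] X t (n + 2)) (h' : X t n →ₗ[R] X t (n + 1)),
      d t (n + 1) ∘ₗ h + h' ∘ₗ d t n = LinearMap.lsmul R (X t (n + 1)) x

namespace PowerResolution

variable {R : Type u} [CommRing R] {I : Ideal R} (P : PowerResolution I)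

instance (t n : ℕ) : Module.Flat R (P.X t n) := P.flat t n

/-- The product over `t` of the degree `n` parts of the resolutions of `R ⧸ I ^ t`, tensored
with `M`. -/
abbrev Prod (n : ℕ) (M : Type u) [AddCommGroup M] [Module R M] : Type u :=
  ∀ t : ℕ, P.X t n ⊗[R] M

section Prod

variable (n : ℕ) (M : Type u) [AddCommGroup M] [Module R M]

/-- The differential of the product complex. -/
noncomputable def dProd : P.Prod (n + 1) M →ₗ[R] P.Prod n M :=
  LinearMap.pi fun t => (P.d t n).rTensor M ∘ₗ LinearMap.proj t

/-- The shift operator of the product complex. -/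
noncomputable def shift : Module.End R (P.Prod n M) :=
  LinearMap.pi fun t => (P.σ t n).rTensor M ∘ₗ LinearMap.proj (t + 1)

variable {n M}

@[simp]
theorem dProd_apply (a : P.Prod (n + 1) M) (t : ℕ) :
    P.dProd n M a t = (P.d t n).rTensor M (a t) := rfl

@[simp]
theorem shift_apply (a : P.Prod n M) (t : ℕ) :
    P.shift n M a t = (P.σ t n).rTensor M (a (t + 1)) := rfl

theorem rTensor_d_d (t : ℕ) (y : P.X t (n + 2) ⊗[R] M) :
    (P.d t n).rTensor M ((P.d t (n + 1)).rTensor M y) = 0 := by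
  rw [← LinearMap.rTensor_comp_apply, P.d_comp_d, LinearMap.rTensor_zero, LinearMap.zero_apply]

theorem dProd_dProd (a : P.Prod (n + 2) M) : P.dProd n M (P.dProd (n + 1) M a) = 0 :=
  funext fun t => P.rTensor_d_d t (a t)

theorem dProd_shift (a : P.Prod (n + 1) M) :
    P.dProd n M (P.shift (n + 1) M a) = P.shift n M (P.dProd n M a) := by
  funext t
  simp only [dProd_apply, shift_apply, ← LinearMap.rTensor_comp_apply, P.d_comp_σ]

theorem dProd_shift_pow (k : ℕ) (a : P.Prod (n + 1) M) :
    P.dProd n M ((P.shift (n + 1) M ^ k) a) = (P.shift n M ^ k) (P.dProd n M a) := by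
  induction k with
  | zero => rfl
  | succ k ih => rw [pow_succ', pow_succ', Module.End.mul_apply, Module.End.mul_apply,
      dProd_shift, ih]

theorem dProd_sum_shift_pow (k : ℕ) (a : P.Prod (n + 1) M) :
    P.dProd n M ((∑ j ∈ Finset.range k, P.shift (n + 1) M ^ j) a) =
      (∑ j ∈ Finset.range k, P.shift n M ^ j) (P.dProd n M a) := by
  simp only [LinearMap.sum_apply, map_sum, dProd_shift_pow]

variable {N Q : Type u} [AddCommGroup N] [Module R N] [AddCommGroup Q] [Module R Q]

/-- Functoriality of the product complex in the module. -/
noncomputable def prodMap (n : ℕ) (f : M →ₗ[R] N) : P.Prod n M →ₗ[R] P.Prod n N :=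
  LinearMap.pi fun t => f.lTensor (P.X t n) ∘ₗ LinearMap.proj t

@[simp]
theorem prodMap_apply (f : M →ₗ[R] N) (a : P.Prod n M) (t : ℕ) :
    P.prodMap n f a t = f.lTensor (P.X t n) (a t) := rfl

theorem dProd_prodMap (f : M →ₗ[R] N) (a : P.Prod (n + 1) M) :
    P.dProd n N (P.prodMap (n + 1) f a) = P.prodMap n f (P.dProd n M a) := by
  funext t
  simp only [dProd_apply, prodMap_apply, ← LinearMap.comp_apply, LinearMap.rTensor_comp_lTensor,
    LinearMap.lTensor_comp_rTensor]

theorem shift_prodMap (f : M →ₗ[R] N) (a : P.Prod n M) :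
    P.shift n N (P.prodMap n f a) = P.prodMap n f (P.shift n M a) := by
  funext t
  simp only [shift_apply, prodMap_apply, ← LinearMap.comp_apply, LinearMap.rTensor_comp_lTensor,
    LinearMap.lTensor_comp_rTensor]

theorem shift_pow_prodMap (k : ℕ) (f : M →ₗ[R] N) (a : P.Prod n M) :
    (P.shift n N ^ k) (P.prodMap n f a) = P.prodMap n f ((P.shift n M ^ k) a) := by
  induction k with
  | zero => rfl
  | succ k ih => rw [pow_succ', pow_succ', Module.End.mul_apply, Module.End.mul_apply,
      ih, shift_prodMap]

/-- This is where flatness of the resolutions enters. With right exactness of the tensor product and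
exactness of products, it makes the product complex exact in the module, with no Mittag-Leffler
condition. -/
theorem prodMap_injective (n : ℕ) {f : M →ₗ[R] N} (hf : Function.Injective f) :
    Function.Injective (P.prodMap n f) := fun _ _ hab => funext fun t =>
  Module.Flat.lTensor_preserves_injective_linearMap (M := P.X t n) f hf (congrFun hab t)

theorem prodMap_surjective (n : ℕ) {f : M →ₗ[R] N} (hf : Function.Surjective f) :
    Function.Surjective (P.prodMap n f) := fun b => by
  choose a ha using fun t => LinearMap.lTensor_surjective (P.X t n) hf (b t)
  exact ⟨a, funext ha⟩

theorem prodMap_exact (n : ℕ) {f : M →ₗ[R] N} {g : N →ₗ[R] Q} (hfg : Function.Exact f g)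
    (hg : Function.Surjective g) : Function.Exact (P.prodMap n f) (P.prodMap n g) := by
  have h := fun t => lTensor_exact (P.X t n) hfg hg
  intro b
  constructor
  · intro hb
    choose a ha using fun t => (h t (b t)).1 (congrFun hb t)
    exact ⟨a, funext ha⟩
  · rintro ⟨a, rfl⟩
    exact funext fun t => (h t).apply_apply_eq_zero (a t)

end Prod

/-! ### The homotopy limit and its long exact sequence -/

/-- The degree `n` part of the homotopy limit over `t` of the complexes `P.X t ⊗ M`, i.e. of the
(shifted) cone of `1 - shift` on the product complex. -/
abbrev Holim (n : ℕ) (M : Type u) [AddCommGroup M] [Module R M] : Type u :=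
  P.Prod n M × P.Prod (n + 1) M

section Holim

variable {n : ℕ} {M N Q : Type u} [AddCommGroup M] [Module R M] [AddCommGroup N] [Module R N]
  [AddCommGroup Q] [Module R Q]

/-- The differential of the homotopy limit. -/
noncomputable def dHolim (n : ℕ) (M : Type u) [AddCommGroup M] [Module R M] :
    P.Holim (n + 1) M →ₗ[R] P.Holim n M :=
  (P.dProd n M ∘ₗ LinearMap.fst R _ _).prod
    ((1 - P.shift (n + 1) M) ∘ₗ LinearMap.fst R _ _ - P.dProd (n + 1) M ∘ₗ LinearMap.snd R _ _)

theorem dHolim_mk (a : P.Prod (n + 1) M) (b : P.Prod (n + 2) M) :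
    P.dHolim n M (a, b) = (P.dProd n M a, a - P.shift (n + 1) M a - P.dProd (n + 1) M b) := rfl

theorem dHolim_dHolim (z : P.Holim (n + 2) M) : P.dHolim n M (P.dHolim (n + 1) M z) = 0 := by
  obtain ⟨a, b⟩ := z
  simp [dHolim_mk, dProd_dProd, dProd_shift]

theorem dHolim_eq_zero_iff {a : P.Prod (n + 1) M} {b : P.Prod (n + 2) M} :
    P.dHolim n M (a, b) = 0 ↔
      P.dProd n M a = 0 ∧ a - P.shift (n + 1) M a = P.dProd (n + 1) M b := by
  rw [dHolim_mk, Prod.mk_eq_zero, sub_eq_zero]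

/-- Functoriality of the homotopy limit in the module. -/
noncomputable def holimMap (n : ℕ) (f : M →ₗ[R] N) : P.Holim n M →ₗ[R] P.Holim n N :=
  (P.prodMap n f).prodMap (P.prodMap (n + 1) f)

theorem holimMap_mk (f : M →ₗ[R] N) (a : P.Prod n M) (b : P.Prod (n + 1) M) :
    P.holimMap n f (a, b) = (P.prodMap n f a, P.prodMap (n + 1) f b) := rfl

theorem dHolim_holimMap (f : M →ₗ[R] N) (z : P.Holim (n + 1) M) :
    P.dHolim n N (P.holimMap (n + 1) f z) = P.holimMap n f (P.dHolim n M z) := by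
  obtain ⟨a, b⟩ := z
  simp [dHolim_mk, holimMap_mk, dProd_prodMap, shift_prodMap]

/-- Allowing any `f` that acts as `x` covers multiplication by `x` factored through its image. -/
theorem holimMap_smul (x : R) (f : M →ₗ[R] M) (hf : ∀ m, f m = x • m) (z : P.Holim n M) :
    P.holimMap n f z = x • z := by
  obtain rfl : f = x • LinearMap.id := LinearMap.ext hf
  obtain ⟨a, b⟩ := z
  refine Prod.ext (funext fun t => ?_) (funext fun t => ?_) <;>
  simp [holimMap_mk, LinearMap.lTensor_smul]

theorem holimMap_comp (f : M →ₗ[R] N) (g : N →ₗ[R] Q) (z : P.Holim n M) :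
    P.holimMap n (g ∘ₗ f) z = P.holimMap n g (P.holimMap n f z) := by
  obtain ⟨a, b⟩ := z
  refine Prod.ext (funext fun t => ?_) (funext fun t => ?_) <;>
  simp [holimMap_mk, LinearMap.lTensor_comp_apply]

theorem holimMap_injective (n : ℕ) {f : M →ₗ[R] N} (hf : Function.Injective f) :
    Function.Injective (P.holimMap n f) :=
  (P.prodMap_injective n hf).prodMap (P.prodMap_injective (n + 1) hf)

theorem holimMap_surjective (n : ℕ) {f : M →ₗ[R] N} (hf : Function.Surjective f) :
    Function.Surjective (P.holimMap n f) :=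
  (P.prodMap_surjective n hf).prodMap (P.prodMap_surjective (n + 1) hf)

theorem holimMap_exact (n : ℕ) {f : M →ₗ[R] N} {g : N →ₗ[R] Q} (hfg : Function.Exact f g)
    (hg : Function.Surjective g) : Function.Exact (P.holimMap n f) (P.holimMap n g) := by
  rintro ⟨a, b⟩
  have h₁ := P.prodMap_exact n hfg hg a
  have h₂ := P.prodMap_exact (n + 1) hfg hg b
  simp only [holimMap_mk, Prod.mk_eq_zero, h₁, h₂, Set.mem_range, Prod.exists, Prod.mk.injEq]
  exact exists_and_exists_comm

/-- Vanishing of the homology of the homotopy limit in degree `i`. In degree `0` the complex is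
truncated, so that this is the vanishing of the cokernel of the last differential. -/
def Vanishes : ℕ → ∀ (M : Type u) [AddCommGroup M] [Module R M], Prop
  | 0, M, _, _ => Function.Surjective (P.dHolim 0 M)
  | i + 1, M, _, _ => Function.Exact (P.dHolim (i + 1) M) (P.dHolim i M)

theorem Vanishes.of_subsingleton (i : ℕ) [Subsingleton M] : P.Vanishes i M := by
  have (n : ℕ) : Subsingleton (P.Holim n M) := inferInstance
  cases i with
  | zero => exact Function.surjective_to_subsingleton _
  | succ i => exact fun z => ⟨fun _ => ⟨0, Subsingleton.elim _ _⟩, fun _ => Subsingleton.elim _ _⟩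

variable {P}

/-- Treats the truncated degree `0` and the positive degrees together: the cycle condition is
vacuous when `i = 0`. -/
theorem Vanishes.exists_eq {i : ℕ} (h : P.Vanishes i M) {z : P.Holim i M}
    (hz : ∀ (j : ℕ) (hj : j + 1 = i), P.dHolim j M (cast (by rw [hj]) z) = 0) :
    ∃ w, P.dHolim i M w = z := by
  cases i with
  | zero => exact h z
  | succ i => exact (h z).1 (hz i rfl)

theorem vanishes_succ_of_exists {i : ℕ}
    (h : ∀ z : P.Holim (i + 1) M, P.dHolim i M z = 0 → ∃ w, P.dHolim (i + 1) M w = z) :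
    P.Vanishes (i + 1) M := fun z => ⟨h z, by rintro ⟨w, rfl⟩; exact P.dHolim_dHolim w⟩

variable {f : M →ₗ[R] N} {g : N →ₗ[R] Q}

/-- If the homology of the kernel vanishes, cycles lift along a surjection. -/
theorem exists_lift_of_vanishes_left {i : ℕ} (hf : Function.Injective f)
    (hfg : Function.Exact f g) (hg : Function.Surjective g) (h : P.Vanishes i M)
    {z : P.Holim (i + 1) Q} (hz : P.dHolim i Q z = 0) :
    ∃ y, P.dHolim i N y = 0 ∧ P.holimMap (i + 1) g y = z := by
  obtain ⟨y, rfl⟩ := P.holimMap_surjective (i + 1) hg z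
  rw [dHolim_holimMap] at hz
  obtain ⟨x, hx⟩ := (P.holimMap_exact i hfg hg _).1 hz
  obtain ⟨w, rfl⟩ := h.exists_eq (z := x) <| by
    rintro j rfl
    apply P.holimMap_injective j hf
    rw [cast_eq, ← dHolim_holimMap, hx, dHolim_dHolim, map_zero]
  refine ⟨y - P.holimMap (i + 1) f w, ?_, ?_⟩
  · rw [map_sub, dHolim_holimMap, hx, sub_self]
  · rw [map_sub, (P.holimMap_exact (i + 1) hfg hg).apply_apply_eq_zero, sub_zero]

/-- If the homology of the quotient vanishes, cycles come from the submodule. -/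
theorem exists_lift_of_vanishes_right {i : ℕ} (hf : Function.Injective f)
    (hfg : Function.Exact f g) (hg : Function.Surjective g) (h : P.Vanishes (i + 1) Q)
    {z : P.Holim (i + 1) N} (hz : P.dHolim i N z = 0) :
    ∃ y w, P.dHolim i M y = 0 ∧ P.holimMap (i + 1) f y + P.dHolim (i + 1) N w = z := by
  obtain ⟨w, hw⟩ := (h (P.holimMap (i + 1) g z)).1 (by rw [dHolim_holimMap, hz, map_zero])
  obtain ⟨w, rfl⟩ := P.holimMap_surjective (i + 2) hg w
  obtain ⟨y, hy⟩ := (P.holimMap_exact (i + 1) hfg hg (z - P.dHolim (i + 1) N w)).1 (by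
    rw [map_sub, ← hw, dHolim_holimMap, sub_self])
  refine ⟨y, w, P.holimMap_injective i hf ?_, by rw [hy, sub_add_cancel]⟩
  rw [← dHolim_holimMap, hy, map_sub, hz, dHolim_dHolim, sub_zero, map_zero]

theorem Vanishes.of_exact {i : ℕ} (hf : Function.Injective f) (hfg : Function.Exact f g)
    (hg : Function.Surjective g) (h₁ : P.Vanishes (i + 1) M) (h₂ : P.Vanishes (i + 1) Q) :
    P.Vanishes (i + 1) N := vanishes_succ_of_exists fun z hz => by
  obtain ⟨y, w, hy, rfl⟩ := exists_lift_of_vanishes_right hf hfg hg h₂ hz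
  obtain ⟨v, rfl⟩ := (h₁ y).1 hy
  exact ⟨P.holimMap (i + 2) f v + w, by rw [map_add, dHolim_holimMap]⟩

end Holim

end PowerResolution

/-! ### Derived completeness -/

namespace PowerResolution

variable {R : Type u} [CommRing R] {I : Ideal R} {P : PowerResolution I}

section Complete

variable {M : Type u} [AddCommGroup M] [Module R M]

/-- The null-homotopy of multiplication by `x` survives tensoring with `M`, so `x` kills the
homology. -/
theorem exists_d_eq_smul {t n : ℕ} {x : R} (hx : x ∈ I ^ t) {y : P.X t (n + 1) ⊗[R] M}
    (hy : (P.d t n).rTensor M y = 0) :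
    ∃ w, (P.d t (n + 1)).rTensor M w = x • y := by
  obtain ⟨h, h', hh⟩ := P.homotopy t x hx n
  refine ⟨h.rTensor M y, ?_⟩
  have := LinearMap.congr_fun (congrArg (LinearMap.rTensor M) hh) y
  rw [LinearMap.rTensor_add, LinearMap.add_apply, LinearMap.rTensor_comp_apply,
    LinearMap.rTensor_comp_apply, hy, map_zero, add_zero] at this
  rw [this, show LinearMap.lsmul R (P.X t (n + 1)) x = x • LinearMap.id from rfl,
    LinearMap.rTensor_smul, LinearMap.rTensor_id, LinearMap.smul_apply, LinearMap.id_apply]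

/-- Unrolling the recursion `z j = x • z (j + 1) + w j`. -/
theorem eq_pow_smul_add_sum {A : Type*} [AddCommGroup A] [Module R A] {x : R} {z w : ℕ → A}
    (h : ∀ j, z j = x • z (j + 1) + w j) (t : ℕ) :
    z 0 = x ^ t • z t + ∑ j ∈ Finset.range t, x ^ j • w j := by
  induction t with
  | zero => simp
  | succ t ih =>
    rw [ih, Finset.sum_range_succ, h t, smul_add, smul_smul, ← pow_succ]
    abel

/-- Derived completeness: if every homology class of the homotopy limit is divisible by an element
of `I`, then the homology vanishes. -/
theorem vanishes_of_divisible {i : ℕ} {x : R} (hx : x ∈ I)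
    (H : ∀ z : P.Holim (i + 1) M, P.dHolim i M z = 0 →
      ∃ z' w, P.dHolim i M z' = 0 ∧ z = x • z' + P.dHolim (i + 1) M w) :
    P.Vanishes (i + 1) M := by
  have hpow (t : ℕ) : x ^ t ∈ I ^ t := Ideal.pow_mem_pow hx t
  -- The image of the class in the product of the homologies at each `t` is zero: iterated division
  -- gives `z = x ^ t • z_t` up to a boundary, and `x ^ t` kills homology at place `t`. What remains
  -- is a `lim¹`-type class `(0, b)`.
  have fst_eq_zero (z : P.Holim (i + 1) M) (hz : P.dHolim i M z = 0) :
      ∃ b c, P.dProd (i + 1) M b = 0 ∧ z = (0, b) + P.dHolim (i + 1) M c := by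
    choose F W hF hW using H
    let S : {z : P.Holim (i + 1) M // P.dHolim i M z = 0} →
      {z : P.Holim (i + 1) M // P.dHolim i M z = 0} := fun z => ⟨F z z.2, hF z z.2⟩
    let Z : ℕ → {z : P.Holim (i + 1) M // P.dHolim i M z = 0} := fun j => S^[j] ⟨z, hz⟩
    have hZ (j : ℕ) : (Z j).1 = x • (Z (j + 1)).1 + P.dHolim (i + 1) M (W (Z j).1 (Z j).2) := by
      have : Z (j + 1) = S (Z j) := Function.iterate_succ_apply' _ _ _
      rw [this]
      exact hW _ _
    have key (t : ℕ) : ∃ c, (P.d t (i + 1)).rTensor M c = z.1 t := by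
      have h₁ := congrFun (congrArg Prod.fst (eq_pow_smul_add_sum hZ t)) t
      obtain ⟨c, hc⟩ := exists_d_eq_smul (P := P) (hpow t) (y := (Z t).1.1 t)
        (congrFun (congrArg Prod.fst (Z t).2) t)
      simp only [← map_smul, ← map_sum] at h₁
      generalize (∑ j ∈ Finset.range t, x ^ j • W (Z j).1 (Z j).2) = v at h₁
      refine ⟨c + v.1 t, ?_⟩
      rw [map_add, hc]
      exact h₁.symm
    choose c hc using key
    have h₂ : z - P.dHolim (i + 1) M (c, 0) = (0, (z - P.dHolim (i + 1) M (c, 0)).2) :=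
      Prod.ext (sub_eq_zero.2 (funext fun t => (hc t).symm)) rfl
    refine ⟨_, (c, 0), ?_, eq_add_of_sub_eq h₂⟩
    have h₃ : P.dHolim i M (z - P.dHolim (i + 1) M (c, 0)) = 0 := by
      rw [map_sub, hz, dHolim_dHolim, sub_zero]
    rw [h₂, dHolim_eq_zero_iff] at h₃
    simpa using h₃.2.symm
  -- Divisibility restricts to the `lim¹` part: the quotient may also be taken of the form `(0,
  -- b')`.
  have H' (b : P.Prod (i + 2) M) (hb : P.dProd (i + 1) M b = 0) :
      ∃ b' u v, P.dProd (i + 1) M b' = 0 ∧ P.dProd (i + 1) M u = 0 ∧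
        b = x • b' + (u - P.shift (i + 2) M u - P.dProd (i + 2) M v) := by
    obtain ⟨z', w, hz', hw⟩ := H (0, b) (dHolim_eq_zero_iff P |>.2 (by simp [hb]))
    obtain ⟨b', c, hb', rfl⟩ := fst_eq_zero z' hz'
    have h₁ : ((0, b) : P.Holim (i + 1) M) =
        x • (0, b') + P.dHolim (i + 1) M (x • c + w) := by
      refine hw.trans ?_
      rw [smul_add, map_add, map_smul]
      exact add_assoc _ _ _
    generalize x • c + w = q at h₁
    obtain ⟨u, v⟩ := q
    rw [dHolim_mk] at h₁
    refine ⟨b', u, v, hb', ?_, congrArg Prod.snd h₁⟩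
    simpa using (congrArg Prod.fst h₁).symm
  refine vanishes_succ_of_exists fun z hz => ?_
  obtain ⟨b, c, hb, rfl⟩ := fst_eq_zero z hz
  suffices h : ∃ w, P.dHolim (i + 1) M w = (0, b) by
    obtain ⟨w, hw⟩ := h
    exact ⟨w + c, by rw [map_add, hw]⟩
  choose F U V hF hU hV using H'
  let S : {b : P.Prod (i + 2) M // P.dProd (i + 1) M b = 0} →
    {b : P.Prod (i + 2) M // P.dProd (i + 1) M b = 0} := fun b => ⟨F b b.2, hF b b.2⟩
  let Z : ℕ → {b : P.Prod (i + 2) M // P.dProd (i + 1) M b = 0} := fun j => S^[j] ⟨b, hb⟩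
  let u : ℕ → P.Prod (i + 2) M := fun j => U (Z j).1 (Z j).2
  let v : ℕ → P.Prod (i + 3) M := fun j => V (Z j).1 (Z j).2
  have hu (j : ℕ) : P.dProd (i + 1) M (u j) = 0 := hU _ _
  have hZ (j : ℕ) : (Z j).1 = x • (Z (j + 1)).1 +
      (u j - P.shift (i + 2) M (u j) - P.dProd (i + 2) M (v j)) := by
    have : Z (j + 1) = S (Z j) := Function.iterate_succ_apply' _ _ _
    rw [this]
    exact hV _ _
  -- The series `∑ x ^ j • u j` should solve `e - shift e = b` up to boundaries. At place `t` it may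
  -- be cut off at `j < t`, since the later terms are boundaries there.
  let e : P.Prod (i + 2) M := fun t => ∑ j ∈ Finset.range t, x ^ j • u j t
  have he : P.dProd (i + 1) M e = 0 := funext fun t => by
    have (j : ℕ) : (P.d t (i + 1)).rTensor M (u j t) = 0 := congrFun (hu j) t
    simp [e, this]
  have key (t : ℕ) : ∃ f, (P.d t (i + 2)).rTensor M f = e t - P.shift (i + 2) M e t - b t := by
    have h₁ := congrFun (eq_pow_smul_add_sum hZ t) t
    -- Two terms with factor `x ^ t` remain: the remainder of the unrolled recursion, and the
    -- summand `j = t` that occurs in `shift e` but not in `e` at place `t`.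
    obtain ⟨f₁, hf₁⟩ := exists_d_eq_smul (P := P) (hpow t)
      (y := (Z t).1 t + P.shift (i + 2) M (u t) t) (by
        have h₂ := congrFun (Z t).2 t
        have h₃ := congrFun (P.dProd_shift (u t)) t
        rw [hu, map_zero] at h₃
        rw [map_add]
        exact (congrArg₂ (· + ·) h₂ h₃).trans (add_zero _))
    refine ⟨∑ j ∈ Finset.range t, x ^ j • v j t - f₁, ?_⟩
    change b t = _ at h₁
    rw [map_sub, hf₁, h₁]
    simp only [e, shift_apply, Pi.add_apply, Pi.smul_apply, Finset.sum_apply, Pi.sub_apply,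
      dProd_apply, map_sum, map_smul, smul_sub, Finset.sum_sub_distrib, Finset.sum_range_succ,
      map_add, smul_add]
    abel
  choose f hf using key
  refine ⟨(e, f), ?_⟩
  rw [dHolim_mk, he]
  refine Prod.ext rfl (funext fun t => ?_)
  simp only [Pi.sub_apply, dProd_apply]
  rw [hf, sub_sub_cancel]

/-- Vanishing for `M` follows from vanishing for the kernel (one degree lower) and the cokernel of
multiplication by an element of `I`. -/
theorem vanishes_of_ker_of_coker {i : ℕ} {x : R} (hx : x ∈ I)
    (h₁ : P.Vanishes i (LinearMap.ker (LinearMap.lsmul R M x)))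
    (h₂ : P.Vanishes (i + 1) (M ⧸ LinearMap.range (LinearMap.lsmul R M x))) :
    P.Vanishes (i + 1) M := by
  refine vanishes_of_divisible hx fun z hz => ?_
  set m := LinearMap.lsmul R M x
  -- Factor `x` as `M ↠ x M ↪ M`: a class on `M` comes from `x M` because of the cokernel, then from
  -- `M` because of the kernel.
  obtain ⟨y, w, hy, rfl⟩ := exists_lift_of_vanishes_right (f := (LinearMap.range m).subtype)
    (g := (LinearMap.range m).mkQ) (Submodule.subtype_injective _)
    (LinearMap.exact_subtype_mkQ _) (Submodule.mkQ_surjective _) h₂ hz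
  obtain ⟨y, hy', rfl⟩ := exists_lift_of_vanishes_left (f := (LinearMap.ker m).subtype)
    (g := m.rangeRestrict) (Submodule.subtype_injective _)
    (LinearMap.exact_iff.2 (by simp)) m.surjective_rangeRestrict h₁ hy
  refine ⟨y, w, hy', ?_⟩
  rw [← holimMap_comp, P.holimMap_smul x _ fun _ => rfl]

end Complete

/-! ### Pro-zero Tor towers and Artin–Rees -/

section ProZero

variable {M N Q : Type u} [AddCommGroup M] [Module R M] [AddCommGroup N] [Module R N]
  [AddCommGroup Q] [Module R Q] {f : M →ₗ[R] N} {g : N →ₗ[R] Q}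

variable (P) in
/-- The inverse system of the `(n + 1)`-st homology modules of `P.X t ⊗ M` is uniformly
pro-zero. -/
def ProZero (n : ℕ) (M : Type u) [AddCommGroup M] [Module R M] : Prop :=
  ∃ k : ℕ, ∀ a : P.Prod (n + 1) M, P.dProd n M a = 0 →
    ∃ w, P.dProd (n + 1) M w = (P.shift (n + 1) M ^ k) a

/-- On homology the shift is nilpotent, so `1 - shift` is inverted by a finite geometric sum. `h₁`
gives injectivity in degree `i + 1`, and `h₂` surjectivity in degree `i + 2`. -/
theorem ProZero.vanishes {i : ℕ} (h₁ : P.ProZero i M) (h₂ : P.ProZero (i + 1) M) :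
    P.Vanishes (i + 1) M := by
  have geom (n k : ℕ) (a : P.Prod n M) :
      a = (P.shift n M ^ k) a +
        (∑ j ∈ Finset.range k, P.shift n M ^ j) (a - P.shift n M a) := by
    have := LinearMap.congr_fun (geom_sum_mul_neg (P.shift n M) k) a
    simp only [Module.End.mul_apply, LinearMap.sub_apply, Module.End.one_apply] at this
    rw [this, add_sub_cancel]
  have geom' (n k : ℕ) (a : P.Prod n M) (S) (hS : S = ∑ j ∈ Finset.range k, P.shift n M ^ j) :
      S a - P.shift n M (S a) = a - (P.shift n M ^ k) a := by
    have := LinearMap.congr_fun (mul_neg_geom_sum (P.shift n M) k) a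
    simpa only [Module.End.mul_apply, LinearMap.sub_apply, Module.End.one_apply, ← hS] using this
  refine vanishes_succ_of_exists ?_
  rintro ⟨a, b⟩ hz
  obtain ⟨ha, hb⟩ := (dHolim_eq_zero_iff P).1 hz
  obtain ⟨k, hk⟩ := h₁
  obtain ⟨k', hk'⟩ := h₂
  obtain ⟨w, hw⟩ := hk a ha
  -- By `geom`, `a` is `shift ^ k a` plus a geometric sum applied to `a - shift a`; both are
  -- boundaries.
  obtain ⟨c, hc⟩ : ∃ c, P.dProd (i + 1) M c = a :=
    ⟨w + (∑ j ∈ Finset.range k, P.shift (i + 2) M ^ j) b, by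
      rw [map_add, hw, dProd_sum_shift_pow, ← hb, ← geom]⟩
  set b' := b - (c - P.shift (i + 2) M c) with hb'
  have hdb' : P.dProd (i + 1) M b' = 0 := by
    rw [hb', map_sub, map_sub, dProd_shift, hc, hb, sub_self]
  obtain ⟨w', hw'⟩ := hk' b' hdb'
  set S := ∑ j ∈ Finset.range k', P.shift (i + 2) M ^ j with hS
  refine ⟨(c, 0) + (S b', -w'), ?_⟩
  rw [map_add, dHolim_mk, dHolim_mk, hc, hS, dProd_sum_shift_pow, hdb', ← hS, geom' _ k' _ S hS,
    map_zero, map_zero, map_neg, hw']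
  refine Prod.ext (add_zero _) ?_
  simp only [Prod.snd_add, hb']
  abel

/-- In the long exact sequence the homology of `Q` sits between those of `N` and `M`: `k` shifts
kill the connecting image, and `k'` more kill the class lifted to `N`. -/
theorem ProZero.succ_of_exact {n : ℕ} (hf : Function.Injective f) (hfg : Function.Exact f g)
    (hg : Function.Surjective g) (h₁ : P.ProZero n M) (h₂ : P.ProZero (n + 1) N) :
    P.ProZero (n + 1) Q := by
  obtain ⟨k, hk⟩ := h₁
  obtain ⟨k', hk'⟩ := h₂
  refine ⟨k' + k, fun z hz => ?_⟩
  obtain ⟨y, rfl⟩ := P.prodMap_surjective _ hg z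
  rw [dProd_prodMap] at hz
  obtain ⟨x, hx⟩ := (P.prodMap_exact _ hfg hg _).1 hz
  obtain ⟨w, hw⟩ := hk x (P.prodMap_injective _ hf (by
    rw [← dProd_prodMap, hx, dProd_dProd, map_zero]))
  obtain ⟨v, hv⟩ := hk' ((P.shift _ _ ^ k) y - P.prodMap _ f w) (by
    rw [map_sub, dProd_prodMap, hw, dProd_shift_pow, ← hx, shift_pow_prodMap, sub_self])
  refine ⟨P.prodMap _ g v, ?_⟩
  rw [dProd_prodMap, hv, map_sub, map_sub, P.shift_pow_prodMap k' f,
    (P.prodMap_exact _ hfg hg).apply_apply_eq_zero, sub_zero, ← shift_pow_prodMap,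
    ← shift_pow_prodMap, pow_add, Module.End.mul_apply]

/-- Bottom of the long exact sequence: the connecting map lands in the kernel of `H_0(M) → H_0(N)`,
which `h₁` makes pro-zero. -/
theorem ProZero.zero_of_exact (hfg : Function.Exact f g) (hg : Function.Surjective g)
    (h₁ : ∃ k, ∀ (x : P.Prod 0 M) (y : P.Prod 1 N), P.dProd 0 N y = P.prodMap 0 f x →
      ∃ w, P.dProd 0 M w = (P.shift 0 M ^ k) x)
    (h₂ : P.ProZero 0 N) : P.ProZero 0 Q := by
  obtain ⟨k, hk⟩ := h₁
  obtain ⟨k', hk'⟩ := h₂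
  refine ⟨k' + k, fun z hz => ?_⟩
  obtain ⟨y, rfl⟩ := P.prodMap_surjective _ hg z
  rw [dProd_prodMap] at hz
  obtain ⟨x, hx⟩ := (P.prodMap_exact _ hfg hg _).1 hz
  obtain ⟨w, hw⟩ := hk x y hx.symm
  obtain ⟨v, hv⟩ := hk' ((P.shift _ _ ^ k) y - P.prodMap _ f w) (by
    rw [map_sub, dProd_prodMap, hw, dProd_shift_pow, ← hx, shift_pow_prodMap, sub_self])
  refine ⟨P.prodMap _ g v, ?_⟩
  rw [dProd_prodMap, hv, map_sub, map_sub, P.shift_pow_prodMap k' f,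
    (P.prodMap_exact _ hfg hg).apply_apply_eq_zero, sub_zero, ← shift_pow_prodMap,
    ← shift_pow_prodMap, pow_add, Module.End.mul_apply]

theorem ProZero.of_flat (n : ℕ) [Module.Flat R M] : P.ProZero n M := by
  refine ⟨0, fun a ha => ?_⟩
  choose w hw using fun t =>
    (Module.Flat.rTensor_exact M (P.exact_d t n) (a t)).1 (congrFun ha t)
  exact ⟨w, funext hw⟩

variable (P) in
/-- The augmentation `P.X t 0 ⊗ M → M ⧸ I ^ t M`. -/
noncomputable def augmentation (t : ℕ) (M : Type u) [AddCommGroup M] [Module R M] :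
    P.X t 0 ⊗[R] M →ₗ[R] M ⧸ (I ^ t • (⊤ : Submodule R M)) :=
  (TensorProduct.quotTensorEquivQuotSMul M (I ^ t)).toLinearMap ∘ₗ (P.ε t).rTensor M

theorem augmentation_eq_zero_iff {t : ℕ} {y : P.X t 0 ⊗[R] M} :
    P.augmentation t M y = 0 ↔ ∃ w, (P.d t 0).rTensor M w = y := by
  rw [augmentation, LinearMap.comp_apply, LinearEquiv.coe_coe, LinearEquiv.map_eq_zero_iff]
  exact rTensor_exact M (P.exact_ε t) (P.surjective_ε t) y

theorem augmentation_tmul {t : ℕ} {p : P.X t 0} {r : R} (hr : P.ε t p = Ideal.Quotient.mk _ r)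
    (m : M) : P.augmentation t M (p ⊗ₜ m) = Submodule.Quotient.mk (r • m) := by
  rw [augmentation, LinearMap.comp_apply, LinearMap.rTensor_tmul, hr]
  exact TensorProduct.quotTensorEquivQuotSMul_mk_tmul _ _ _

theorem augmentation_lTensor {t : ℕ} (f : M →ₗ[R] N) (y : P.X t 0 ⊗[R] M) {m : M}
    (hm : P.augmentation t M y = Submodule.Quotient.mk m) :
    P.augmentation t N (f.lTensor _ y) = Submodule.Quotient.mk (f m) := by
  have hle : I ^ t • (⊤ : Submodule R M) ≤ (I ^ t • (⊤ : Submodule R N)).comap f := by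
    rw [← Submodule.map_le_iff_le_comap, Submodule.map_smul'']
    exact Submodule.smul_mono le_rfl le_top
  have : P.augmentation t N ∘ₗ f.lTensor _ =
      Submodule.mapQ _ _ f hle ∘ₗ P.augmentation t M := TensorProduct.ext' fun p m => by
    obtain ⟨r, hr⟩ := Ideal.Quotient.mk_surjective (P.ε t p)
    rw [LinearMap.comp_apply, LinearMap.comp_apply, LinearMap.lTensor_tmul,
      augmentation_tmul hr.symm, augmentation_tmul hr.symm, Submodule.mapQ_apply, map_smul]
  rw [← LinearMap.comp_apply, this, LinearMap.comp_apply, hm, Submodule.mapQ_apply]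

theorem augmentation_rTensor_σ {t : ℕ} (y : P.X (t + 1) 0 ⊗[R] M) {m : M}
    (hm : P.augmentation (t + 1) M y = Submodule.Quotient.mk m) :
    P.augmentation t M ((P.σ t 0).rTensor M y) = Submodule.Quotient.mk m := by
  have hle : I ^ (t + 1) • (⊤ : Submodule R M) ≤
      (I ^ t • (⊤ : Submodule R M)).comap LinearMap.id :=
    Submodule.smul_mono_left (Ideal.pow_le_pow_right t.le_succ)
  have : P.augmentation t M ∘ₗ (P.σ t 0).rTensor M =
      Submodule.mapQ _ _ LinearMap.id hle ∘ₗ P.augmentation (t + 1) M :=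
    TensorProduct.ext' fun p m => by
      obtain ⟨r, hr⟩ := Ideal.Quotient.mk_surjective (P.ε (t + 1) p)
      rw [LinearMap.comp_apply, LinearMap.comp_apply, LinearMap.rTensor_tmul,
        augmentation_tmul hr.symm, augmentation_tmul (r := r) (by rw [P.ε_comp_σ, ← hr]; rfl),
        Submodule.mapQ_apply, LinearMap.id_apply]
  rw [← LinearMap.comp_apply, this, LinearMap.comp_apply, hm, Submodule.mapQ_apply,
    LinearMap.id_apply]

theorem augmentation_shift_pow (k : ℕ) {t : ℕ} (a : P.Prod 0 M) {m : M}
    (hm : P.augmentation (t + k) M (a (t + k)) = Submodule.Quotient.mk m) :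
    P.augmentation t M ((P.shift 0 M ^ k) a t) = Submodule.Quotient.mk m := by
  induction k generalizing a with
  | zero => exact hm
  | succ k ih =>
    rw [pow_succ, Module.End.mul_apply]
    exact ih _ (augmentation_rTensor_σ _ hm)

/-- An Artin–Rees type condition on `f : M → N` makes the system of the kernels of
`M ⧸ I ^ t M → N ⧸ I ^ t N` pro-zero. -/
theorem exists_dProd_eq_shift_pow {k : ℕ}
    (hf : ∀ t, (I ^ (t + k) • (⊤ : Submodule R N)).comap f ≤ I ^ t • ⊤)
    (x : P.Prod 0 M) (y : P.Prod 1 N) (hy : P.dProd 0 N y = P.prodMap 0 f x) :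
    ∃ w, P.dProd 0 M w = (P.shift 0 M ^ k) x := by
  have key (t : ℕ) : ∃ w, (P.d t 0).rTensor M w = (P.shift 0 M ^ k) x t := by
    obtain ⟨m, hm⟩ := Submodule.Quotient.mk_surjective _ (P.augmentation (t + k) M (x (t + k)))
    rw [← augmentation_eq_zero_iff, augmentation_shift_pow k x hm.symm,
      Submodule.Quotient.mk_eq_zero]
    refine hf t ?_
    rw [Submodule.mem_comap, ← Submodule.Quotient.mk_eq_zero, ← augmentation_lTensor f _ hm.symm,
      augmentation_eq_zero_iff]
    exact ⟨y (t + k), congrFun hy _⟩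
  choose w hw using key
  exact ⟨w, funext hw⟩

theorem ProZero.of_finite [IsNoetherianRing R] (n : ℕ) (M : Type u) [AddCommGroup M] [Module R M]
    [Module.Finite R M] : P.ProZero n M := by
  induction n generalizing M with
  | zero =>
    obtain ⟨m, g, hg⟩ := Module.Finite.exists_fin' R M
    refine ProZero.zero_of_exact (f := (LinearMap.ker g).subtype) (g := g)
      (LinearMap.exact_subtype_ker_map g) hg ?_ (ProZero.of_flat 0)
    -- Artin–Rees for the relation module inside the free module supplies the uniform shift.
    obtain ⟨k, hk⟩ := Ideal.exists_pow_inf_eq_pow_smul I (LinearMap.ker g)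
    refine ⟨k, exists_dProd_eq_shift_pow fun t y hy => ?_⟩
    have h₁ : (y : Fin m → R) ∈ I ^ (t + k) • (⊤ : Submodule R (Fin m → R)) ⊓ LinearMap.ker g :=
      ⟨hy, y.2⟩
    rw [hk _ (Nat.le_add_left k t), Nat.add_sub_cancel] at h₁
    have h₂ := Submodule.smul_mono (le_refl (I ^ t)) inf_le_right h₁
    have h₃ : (I ^ t • (⊤ : Submodule R (LinearMap.ker g))).map (LinearMap.ker g).subtype =
        I ^ t • LinearMap.ker g := by
      rw [Submodule.map_smul'', Submodule.map_top, Submodule.range_subtype]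
    rw [← h₃] at h₂
    obtain ⟨y', hy', h⟩ := h₂
    rwa [← Subtype.ext (h : (y' : Fin m → R) = y)]
  | succ n ih =>
    obtain ⟨m, g, hg⟩ := Module.Finite.exists_fin' R M
    exact ProZero.succ_of_exact (Submodule.subtype_injective _)
      (LinearMap.exact_subtype_ker_map g) hg (ih _) (ProZero.of_flat _)

theorem exists_finset_sum_lsingle {X ι : Type*} [AddCommGroup X] [Module R X]
    (y : X ⊗[R] (ι →₀ N)) : ∃ S : Finset ι, ∀ S', S ⊆ S' →
      ∑ j ∈ S', (Finsupp.lsingle (R := R) j).lTensor X ((Finsupp.lapply (R := R) j).lTensor X y)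
        = y := by
  classical
  induction y with
  | zero => exact ⟨∅, by simp⟩
  | tmul p f =>
    refine ⟨f.support, fun S' hS => ?_⟩
    simp only [LinearMap.lTensor_tmul, ← TensorProduct.tmul_sum, Finsupp.lapply_apply,
      Finsupp.lsingle_apply]
    congr 1
    conv_rhs => rw [← Finsupp.sum_single f]
    exact (Finsupp.sum_of_support_subset _ hS _ (by simp)).symm
  | add y z hy hz =>
    obtain ⟨S, hS⟩ := hy
    obtain ⟨T, hT⟩ := hz
    refine ⟨S ∪ T, fun S' h => ?_⟩
    simp only [map_add, Finset.sum_add_distrib]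
    rw [hS S' (Finset.union_subset_left h), hT S' (Finset.union_subset_right h)]

/-- One `k` serves every coordinate. The coordinatewise bounding chains are summed over a finite set
depending on `t`, because a tensor has finite support. -/
theorem ProZero.finsupp {n : ℕ} (h : P.ProZero n N) (ι : Type u) : P.ProZero n (ι →₀ N) := by
  obtain ⟨k, hk⟩ := h
  refine ⟨k, fun a ha => ?_⟩
  choose w hw using fun j : ι => hk (P.prodMap _ (Finsupp.lapply j) a) (by
    rw [dProd_prodMap, ha, map_zero])
  choose S hS using fun t => exists_finset_sum_lsingle ((P.shift (n + 1) (ι →₀ N) ^ k) a t)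
  refine ⟨fun t => ∑ j ∈ S t, P.prodMap _ (Finsupp.lsingle j) (w j) t, funext fun t => ?_⟩
  rw [← hS t (S t) subset_rfl, dProd_apply, map_sum]
  refine Finset.sum_congr rfl fun j _ => ?_
  rw [← dProd_apply, dProd_prodMap, hw, shift_pow_prodMap]
  rfl

/-- The Artin–Rees condition is trivial here, because `I ^ (t + m) N = 0`. -/
theorem ProZero.zero_of_pow_le_annihilator {m : ℕ} (hN : I ^ m ≤ Module.annihilator R N)
    (hg : Function.Surjective g) (h : P.ProZero 0 N) : P.ProZero 0 Q := by
  refine ProZero.zero_of_exact (f := (LinearMap.ker g).subtype) (g := g)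
    (LinearMap.exact_subtype_ker_map g) hg ?_ h
  refine ⟨m, exists_dProd_eq_shift_pow fun t y hy => ?_⟩
  have h₁ : I ^ (t + m) • (⊤ : Submodule R N) = ⊥ := by
    rw [eq_bot_iff, Submodule.smul_le]
    exact fun r hr z _ =>
      Module.mem_annihilator.1 (hN (Ideal.pow_le_pow_right (Nat.le_add_left m t) hr)) z
  rw [h₁, Submodule.mem_comap, Submodule.mem_bot] at hy
  rw [Subtype.ext (hy.trans Submodule.coe_zero.symm)]
  exact Submodule.zero_mem _

theorem ProZero.succ_of_surjective {n : ℕ} (hg : Function.Surjective g)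
    (h₁ : P.ProZero n (LinearMap.ker g)) (h₂ : P.ProZero (n + 1) N) : P.ProZero (n + 1) Q :=
  ProZero.succ_of_exact (Submodule.subtype_injective _) (LinearMap.exact_subtype_ker_map g) hg h₁ h₂

theorem exists_surjective_finsupp_quotient {J : Ideal R} (hM : J ≤ Module.annihilator R M) :
    ∃ g : (M →₀ R ⧸ J) →ₗ[R] M, Function.Surjective g := by
  refine ⟨Finsupp.lsum R fun y => Submodule.liftQ J (LinearMap.toSpanSingleton R M y)
    fun r hr => Module.mem_annihilator.1 (hM hr) y,
    fun y => ⟨Finsupp.single y (Submodule.Quotient.mk 1), ?_⟩⟩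
  rw [Finsupp.lsum_single]
  exact one_smul R y

/-- Dimension shifting along a surjection from a direct sum of copies of the finite module `R ⧸ I ^
m`; its kernel is again killed by `I ^ m`. -/
theorem ProZero.of_pow_le_annihilator [IsNoetherianRing R] {m : ℕ} (n : ℕ)
    (M : Type u) [AddCommGroup M] [Module R M] (hM : I ^ m ≤ Module.annihilator R M) :
    P.ProZero n M := by
  have hann (L : Type u) : I ^ m ≤ Module.annihilator R (L →₀ R ⧸ I ^ m) := fun r hr =>
    Module.mem_annihilator.2 fun y => Finsupp.ext fun j => by
      rw [Finsupp.smul_apply, Finsupp.zero_apply]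
      obtain ⟨s, hs⟩ := Ideal.Quotient.mk_surjective (y j)
      rw [← hs]
      exact Ideal.Quotient.eq_zero_iff_mem.2 (Ideal.mul_mem_right s _ hr)
  have hfin (n : ℕ) (L : Type u) : P.ProZero n (L →₀ R ⧸ I ^ m) :=
    (ProZero.of_finite n (R ⧸ I ^ m)).finsupp L
  induction n generalizing M with
  | zero =>
    obtain ⟨g, hg⟩ := exists_surjective_finsupp_quotient hM
    exact ProZero.zero_of_pow_le_annihilator (hann M) hg (hfin 0 M)
  | succ n ih =>
    obtain ⟨g, hg⟩ := exists_surjective_finsupp_quotient hM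
    exact ProZero.succ_of_surjective hg (ih _ ((hann M).trans
      (LinearMap.annihilator_le_of_injective _ (LinearMap.ker g).subtype_injective))) (hfin _ M)

end ProZero

/-- If `Ndim M < i`, then the `i`-th homology of the homotopy limit vanishes. Working with the
homotopy limit makes the long exact sequences available for all modules, so that no linear
compactness is needed. -/
theorem vanishes_of_ndimLT [IsNoetherianRing R] (P : PowerResolution I) {i : ℕ} {M : Type u}
    [AddCommGroup M] [Module R M] (hM : NdimLT R i M) : P.Vanishes i M := by
  induction i generalizing M with
  | zero =>
    have : Subsingleton M := hM
    exact Vanishes.of_subsingleton P 0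
  | succ i ihi =>
    -- Inducting on an ideal contained in the annihilator, rather than on the annihilator itself,
    -- lets the next step use `J ⊔ (x ^ l)` directly.
    obtain ⟨J, hJ⟩ : ∃ J, J ≤ Module.annihilator R M := ⟨_, le_rfl⟩
    induction J using WellFoundedGT.induction generalizing M with
    | ind J ih =>
    by_cases hIJ : I ≤ J.radical
    · obtain ⟨m, hm⟩ := Ideal.exists_pow_le_of_le_radical_of_fg hIJ (IsNoetherian.noetherian I)
      exact (ProZero.of_pow_le_annihilator i M (hm.trans hJ)).vanishes
        (ProZero.of_pow_le_annihilator (i + 1) M (hm.trans hJ))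
    · obtain ⟨x, hxI, hxJ⟩ := SetLike.not_le_iff_exists.1 hIJ
      obtain ⟨k, hk, hker⟩ := hM.exists_pow_torsion x
      -- Since `x` is outside the radical of `J`, adjoining any power of `x` enlarges `J` strictly.
      -- This is applied to `N ⧸ x N` and to `M ⧸ x ^ k M`.
      have coker (N : Type u) [AddCommGroup N] [Module R N] (hN : NdimLT R (i + 1) N)
          (hJN : J ≤ Module.annihilator R N) (y : R) (hy : ∃ l, x ^ l = y) :
          P.Vanishes (i + 1) (N ⧸ LinearMap.range (LinearMap.lsmul R N y)) := by
        obtain ⟨l, rfl⟩ := hy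
        refine ih (J ⊔ Ideal.span {x ^ l}) ?_ (hN.of_surjective _ (Submodule.mkQ_surjective _)) ?_
        · refine lt_of_le_of_ne le_sup_left fun h => hxJ ⟨l, h ▸ ?_⟩
          exact Ideal.mem_sup_right (Ideal.mem_span_singleton_self _)
        · refine sup_le (hJN.trans ?_) ?_
          · exact (Submodule.mkQ _).annihilator_le_of_surjective (Submodule.mkQ_surjective _)
          · rw [Ideal.span_singleton_le_iff_mem, Module.mem_annihilator]
            refine (Submodule.mkQ_surjective _).forall.2 fun y => ?_
            rw [← map_smul, Submodule.mkQ_apply, Submodule.Quotient.mk_eq_zero]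
            exact ⟨y, rfl⟩
      set N := LinearMap.range (LinearMap.lsmul R M (x ^ k))
      have hN : P.Vanishes (i + 1) N := by
        refine vanishes_of_ker_of_coker hxI (ihi hker) ?_
        exact coker N (hM.of_injective _ N.subtype_injective)
          (hJ.trans (N.subtype.annihilator_le_of_injective N.subtype_injective)) x ⟨1, pow_one x⟩
      exact Vanishes.of_exact N.subtype_injective (LinearMap.exact_subtype_mkQ _)
        N.mkQ_surjective hN (coker M hM hJ _ ⟨k, rfl⟩)

end PowerResolution

/-! ### Projective resolutions of the quotients by powers -/

section Resolution

variable {R : Type u} [CommRing R] (I : Ideal R)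

/-- The projection `R ⧸ I ^ (t + 1) → R ⧸ I ^ t` as a morphism of the system of the quotients by
the powers of `I`. -/
noncomputable def powerQuotientMap (t : ℕ) :
    (localCohomology.ringModIdeals (localCohomology.idealPowersDiagram I)).obj (op (t + 1)) ⟶
      (localCohomology.ringModIdeals (localCohomology.idealPowersDiagram I)).obj (op t) :=
  (localCohomology.ringModIdeals (localCohomology.idealPowersDiagram I)).map
    (homOfLE t.le_succ).op

theorem powerQuotientMap_apply (t : ℕ) (q : R ⧸ I ^ (t + 1)) :
    (powerQuotientMap I t).hom q =
      Ideal.Quotient.factor (Ideal.pow_le_pow_right t.le_succ) q := by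
  obtain ⟨r, rfl⟩ := Ideal.Quotient.mk_surjective q
  rfl

/-- The chosen projective resolution of `R ⧸ I ^ t`. -/
noncomputable def powerProjectiveResolution (t : ℕ) : ProjectiveResolution
    ((localCohomology.ringModIdeals (localCohomology.idealPowersDiagram I)).obj (op t)) :=
  projectiveResolution _

/-- A chain map between projective resolutions lifting `R ⧸ I ^ (t + 1) → R ⧸ I ^ t`. -/
noncomputable def powerResolutionMap (t : ℕ) :
    (powerProjectiveResolution I (t + 1)).complex ⟶ (powerProjectiveResolution I t).complex :=
  ProjectiveResolution.lift (powerQuotientMap I t) _ _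

/-- Multiplication by `x` on the resolution lifts the zero map of `Z`, and lifts are unique up to
homotopy. -/
theorem ProjectiveResolution.nonempty_homotopy_smul {Z : ModuleCat.{u} R}
    (Q : ProjectiveResolution Z) {x : R} (hx : ∀ z : Z, x • z = 0) :
    Nonempty (Homotopy (x • 𝟙 Q.complex) 0) := by
  refine ⟨ProjectiveResolution.liftHomotopyZero _ ?_⟩
  ext1
  refine ModuleCat.hom_ext (LinearMap.ext fun y => ?_)
  exact (map_smul (Q.π.f 0).hom x y).trans (hx _)

/-- The system of the chosen projective resolutions of the modules `R ⧸ I ^ t`. -/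
noncomputable def powerResolution : PowerResolution I where
  X t n := (powerProjectiveResolution I t).complex.X n
  d t n := ((powerProjectiveResolution I t).complex.d (n + 1) n).hom
  σ t n := ((powerResolutionMap I t).f n).hom
  ε t := ((powerProjectiveResolution I t).π.f 0).hom
  d_comp_d t n := congrArg ModuleCat.Hom.hom
    ((powerProjectiveResolution I t).complex.d_comp_d (n + 2) (n + 1) n)
  d_comp_σ t n := congrArg ModuleCat.Hom.hom ((powerResolutionMap I t).comm (n + 1) n)
  ε_comp_σ t y := by
    have := LinearMap.congr_fun (congrArg ModuleCat.Hom.hom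
      (ProjectiveResolution.lift_commutes_zero (powerQuotientMap I t)
        (powerProjectiveResolution I (t + 1)) (powerProjectiveResolution I t))) y
    exact this.trans (powerQuotientMap_apply I t _)
  flat t n := by
    have := (powerProjectiveResolution I t).projective n
    have := (IsProjective.iff_projective _).2 this
    infer_instance
  exact_d t n := (ShortComplex.ShortExact.moduleCat_exact_iff_function_exact _).1
    ((powerProjectiveResolution I t).exact_succ n)
  exact_ε t := (ShortComplex.ShortExact.moduleCat_exact_iff_function_exact _).1
    (powerProjectiveResolution I t).exact₀
  surjective_ε t := (ModuleCat.epi_iff_surjective _).1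
    (inferInstanceAs (Epi ((powerProjectiveResolution I t).π.f 0)))
  homotopy t x hx n := by
    obtain ⟨h⟩ := ProjectiveResolution.nonempty_homotopy_smul (powerProjectiveResolution I t)
      (x := x) (fun z => by
        obtain ⟨r, rfl⟩ := Ideal.Quotient.mk_surjective (I := I ^ t) z
        exact Ideal.Quotient.eq_zero_iff_mem.2 (Ideal.mul_mem_right r _ hx))
    have := h.comm (n + 1)
    rw [Homotopy.dNext_succ_chainComplex, Homotopy.prevD_chainComplex] at this
    refine ⟨(h.hom (n + 1) (n + 2)).hom, (h.hom n (n + 1)).hom, ?_⟩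
    have := congrArg ModuleCat.Hom.hom this
    refine Eq.trans ?_ this.symm
    simp only [HomologicalComplex.zero_f, add_zero, ModuleCat.hom_add, ModuleCat.hom_comp]
    exact add_comm _ _

end Resolution

/-! ### Homology of chain complexes in terms of elements -/

section Homology

variable {R : Type u} [CommRing R]

theorem ChainComplex.exists_cycle_of_homology (K : ChainComplex (ModuleCat.{u} R) ℕ) (i : ℕ)
    (c : K.homology i) : ∃ z : K.cycles i, K.homologyπ i z = c :=
  (ModuleCat.epi_iff_surjective _).1 (inferInstanceAs (Epi (K.homologyπ i))) c

theorem ChainComplex.homologyπ_eq_zero_iff (K : ChainComplex (ModuleCat.{u} R) ℕ) (i : ℕ)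
    (z : K.cycles i) : K.homologyπ i z = 0 ↔
      ∃ b : K.X (i + 1), (K.d (i + 1) i).hom b = (K.iCycles i).hom z := by
  have h := (ShortComplex.ShortExact.moduleCat_exact_iff_function_exact _).1
    (ShortComplex.exact_of_g_is_cokernel
      (ShortComplex.mk _ _ (K.toCycles_comp_homologyπ (i + 1) i)) (K.homologyIsCokernel (i + 1) i (by simp)))
  have hinj := (ModuleCat.mono_iff_injective (K.iCycles i)).1 inferInstance
  have hd (b : K.X (i + 1)) : (K.iCycles i).hom ((K.toCycles (i + 1) i).hom b) =
      (K.d (i + 1) i).hom b :=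
    LinearMap.congr_fun (congrArg ModuleCat.Hom.hom (K.toCycles_i (i + 1) i)) b
  refine (h z).trans ⟨?_, ?_⟩
  · rintro ⟨b, rfl⟩
    exact ⟨b, (hd b).symm⟩
  · rintro ⟨b, hb⟩
    exact ⟨b, hinj ((hd b).trans hb)⟩

theorem ChainComplex.homologyMap_homologyπ {K L : ChainComplex (ModuleCat.{u} R) ℕ} (φ : K ⟶ L)
    (i : ℕ) (z : K.cycles i) : (HomologicalComplex.homologyMap φ i).hom (K.homologyπ i z) =
      L.homologyπ i ((HomologicalComplex.cyclesMap φ i).hom z) :=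
  LinearMap.congr_fun (congrArg ModuleCat.Hom.hom (HomologicalComplex.homologyπ_naturality φ i)) z

theorem ChainComplex.iCycles_cyclesMap {K L : ChainComplex (ModuleCat.{u} R) ℕ} (φ : K ⟶ L)
    (i : ℕ) (z : K.cycles i) : (L.iCycles i).hom ((HomologicalComplex.cyclesMap φ i).hom z) =
      (φ.f i).hom ((K.iCycles i).hom z) :=
  LinearMap.congr_fun (congrArg ModuleCat.Hom.hom (HomologicalComplex.cyclesMap_i φ i)) z

end Homology

/-! ### From the homotopy limit to local homology -/

section LocalHomology

variable {R : Type u} [CommRing R] (I : Ideal R) (M : Type u) [AddCommGroup M] [Module R M]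

/-- The resolution of `R ⧸ I ^ t` tensored with `M`. -/
noncomputable def powerTensorComplex (t : ℕ) : ChainComplex (ModuleCat.{u} R) ℕ :=
  (((MonoidalCategory.tensoringRight (ModuleCat.{u} R)).obj
    (ModuleCat.of R M)).mapHomologicalComplex _).obj (powerProjectiveResolution I t).complex

/-- The transition maps of the complexes `powerTensorComplex`. -/
noncomputable def powerTensorComplexMap (t : ℕ) :
    powerTensorComplex I M (t + 1) ⟶ powerTensorComplex I M t :=
  (((MonoidalCategory.tensoringRight (ModuleCat.{u} R)).obj
    (ModuleCat.of R M)).mapHomologicalComplex _).map (powerResolutionMap I t)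

/-- `Tor_i(R ⧸ I ^ t, M)` as the homology of `powerTensorComplex`. -/
noncomputable def torIso (i t : ℕ) : (localHomologyDiagram I i (ModuleCat.of R M)).obj (op t) ≅
    (powerTensorComplex I M t).homology i :=
  (powerProjectiveResolution I t).isoLeftDerivedObj
    ((MonoidalCategory.tensoringRight (ModuleCat.{u} R)).obj (ModuleCat.of R M)) i

theorem torIso_naturality (i t : ℕ) :
    (localHomologyDiagram I i (ModuleCat.of R M)).map (homOfLE t.le_succ).op ≫
        (torIso I M i t).hom =
      (torIso I M i (t + 1)).hom ≫
        HomologicalComplex.homologyMap (powerTensorComplexMap I M t) i :=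
  ProjectiveResolution.isoLeftDerivedObj_hom_naturality (powerQuotientMap I t)
    (powerProjectiveResolution I (t + 1)) (powerProjectiveResolution I t) (powerResolutionMap I t)
    (ProjectiveResolution.lift_commutes_zero _ _ _)
    ((MonoidalCategory.tensoringRight (ModuleCat.{u} R)).obj (ModuleCat.of R M)) i

variable {M}

/-- The Milnor argument: cycles `a` representing a compatible family satisfy `a - shift a = d b`, so
`(a, b)` is a cycle of the homotopy limit. If it bounds, so does each `a t`. -/
theorem eq_zero_of_vanishes {i : ℕ} (h : (powerResolution I).Vanishes i M)
    (c : ∀ t, (powerTensorComplex I M t).homology i)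
    (hc : ∀ t, (HomologicalComplex.homologyMap (powerTensorComplexMap I M t) i).hom (c (t + 1)) =
      c t) (t : ℕ) : c t = 0 := by
  choose z hz using fun t => ChainComplex.exists_cycle_of_homology _ i (c t)
  let a : (powerResolution I).Prod i M := fun t => ((powerTensorComplex I M t).iCycles i).hom (z t)
  have hb (t : ℕ) : ∃ b : (powerResolution I).X t (i + 1) ⊗[R] M,
      ((powerResolution I).d t i).rTensor M b = a t - (powerResolution I).shift i M a t := by
    have h₁ : (powerTensorComplex I M t).homologyπ i
        (z t - (HomologicalComplex.cyclesMap (powerTensorComplexMap I M t) i).hom (z (t + 1))) =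
        0 := by
      rw [map_sub, ← ChainComplex.homologyMap_homologyπ, hz, hz, hc, sub_self]
    obtain ⟨b, hb⟩ := (ChainComplex.homologyπ_eq_zero_iff _ _ _).1 h₁
    rw [map_sub, ChainComplex.iCycles_cyclesMap] at hb
    exact ⟨b, hb⟩
  choose b hb using hb
  obtain ⟨⟨a', b'⟩, hab⟩ : ∃ w, (powerResolution I).dHolim i M w = (a, b) := by
    refine h.exists_eq fun j hj => ?_
    have ha (t : ℕ) : ((powerTensorComplex I M t).d i j).hom (a t) = 0 :=
      LinearMap.congr_fun (congrArg ModuleCat.Hom.hom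
        ((powerTensorComplex I M t).iCycles_d i j)) (z t)
    clear_value a
    subst hj
    rw [cast_eq, PowerResolution.dHolim_eq_zero_iff]
    exact ⟨funext ha, funext fun t => (hb t).symm⟩
  rw [← hz]
  exact (ChainComplex.homologyπ_eq_zero_iff _ _ _).2
    ⟨a' t, congrFun (congrArg Prod.fst hab) t⟩

theorem subsingleton_localHomology_of_vanishes {i : ℕ}
    (h : (powerResolution I).Vanishes i M) :
    Subsingleton (localHomology I i (ModuleCat.of R M)) := by
  suffices H : ∀ y : localHomology I i (ModuleCat.of R M), y = 0 from
    ⟨fun y y' => (H y).trans (H y').symm⟩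
  intro y
  let F := localHomologyDiagram I i (ModuleCat.of R M)
  have H := eq_zero_of_vanishes I h
    (fun t => (torIso I M i t).hom.hom ((Limits.limit.π F (op t)).hom y)) (fun t => by
      have h₁ := LinearMap.congr_fun (congrArg ModuleCat.Hom.hom (torIso_naturality I M i t))
        ((Limits.limit.π F (op (t + 1))).hom y)
      have h₂ := LinearMap.congr_fun (congrArg ModuleCat.Hom.hom
        (Limits.limit.w F (homOfLE t.le_succ).op)) y
      refine h₁.symm.trans ?_
      exact congrArg (torIso I M i t).hom.hom h₂)
  refine Limits.Concrete.limit_ext F y 0 fun t => ?_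
  refine Eq.trans ?_ (map_zero (Limits.limit.π F t).hom).symm
  exact (ModuleCat.mono_iff_injective _).1 (inferInstanceAs (Mono (torIso I M i t.unop).hom))
    ((H t.unop).trans (map_zero (torIso I M i t.unop).hom.hom).symm)

end LocalHomology

/-- If `M` is a linearly compact module over a commutative Noetherian ring and `Ndim M = d`,
then `H^I_i(M) = 0` for all `i > d`. -/
theorem theorem4p8 {R : Type u} [CommRing R] [IsNoetherianRing R] (I : Ideal R)
    {M : Type u} [AddCommGroup M] [Module R M] [TopologicalSpace M]
    (hM : IsLinearlyCompact R M) (d : WithBot Ordinal.{u}) (hd : HasNdim R d M)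
    (i : ℕ) (hi : d < (((i : Ordinal.{u})) : WithBot Ordinal.{u})) :
    Subsingleton (localHomology I i (ModuleCat.of R M)) :=
  subsingleton_localHomology_of_vanishes I
    (PowerResolution.vanishes_of_ndimLT _ (NdimLT.of_hasNdim hd hi))
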